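/- Let $\mathrm{Prop}$ be a finite set of propositional variables. Modal formulas over $\mathrm{Prop}$ are built from variables $p\in\mathrm{Prop}$, $\top,\bot,\neg_{\mathrm{at}}p,\wedge,\vee,\Diamond,\Box$, and are interpreted as usual on pointed Kripke models $(M,s)$, $M=(W,R,v)$ with $v:W\to\mathcal P(\mathrm{Prop})$. For a set $S$ of operators let $\mathcal L_S[\mathrm{Prop}]$ be the set of formulas generated from the variables using only operators in $S$. Let $\mathcal F$ be either the class of all finite frames or the class of all frames, and let $\mathbb C(\mathcal L)$ be the concept class whose examples are the pointed models based on frames in $\mathcal F$ and whose concepts are the formulas $\varphi\in\mathcal L$, where $\varphi$ represents the set of examples at which it is true; two formulas are equivalent if they represent the same set. A finite characterisation of $\varphi\in\mathcal L$ with respect to $\mathbb C(\mathcal L)$ is a pair $(E^+,E^-)$ of finite sets of examples such that $\varphi$ is true on all of $E^+$ and false on all of $E^-$, and every $\psi\in\mathcal L$ with this property is equivalent to $\varphi$. Theorem. (1) $\mathbb C(\mathcal L_{\Box,\wedge,\vee,\top,\bot}[\mathrm{Prop}])$ admits finite characterisations, i.e. every formula $\varphi\in\mathcal L_{\Box,\wedge,\vee,\top,\bot}[\mathrm{Prop}]$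 has a finite characterisation with respect to this concept class. (2) These characterisations are effectively computable: there is an algorithm that, given $\varphi\in\mathcal L_{\Box,\wedge,\vee,\top,\bot}[\mathrm{Prop}]$, outputs two finite lists of explicitly described finite pointed models that form a finite characterisation of $\varphi$ with respect to this concept class. (3) For $\varphi\in\mathcal L_{\Box,\wedge,\vee,\top,\bot}[\mathrm{Prop}]$ let $\triangleleft(\varphi)$ be obtained from $\varphi$ by replacing each connective by its dual (exchanging $\wedge$ with $\vee$, $\Box$ with $\Diamond$, and $\top$ with $\bot$, and leaving variables unchanged), and for $M=(W,R,v)$ let $M^{\neg}=(W,R,v^{\neg})$ with $v^{\neg}(t)=\mathrm{Prop}\setminus v(t)$. Then $\triangleleft(\varphi)\in\mathcal L_{\Diamond,\wedge,\vee,\top,\bot}[\mathrm{Prop}]$, and a pair $(E^+,E^-)$ of sets of pointed models is a finite characterisation of $\triangleleft(\varphi)$ with respect to $\mathbb C(\mathcal L_{\Diamond,\wedge,\vee,\top,\bot}[\mathrm{Prop}])$ if and only if the pair $$\big(\{(M^{\neg},s)\mid (M,s)\in E^-\},\ \{(M^{\neg},s)\mid (M,s)\in E^+\}\big)$$ is a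 finite characterisation of $\varphi$ with respect to $\mathbb C(\mathcal L_{\Box,\wedge,\vee,\top,\bot}[\mathrm{Prop}])$. -/

import Mathlib

universe u v

namespace ModalChar

/-- Formulas of the full modal language over the propositional variables `P`. -/
inductive Formula (P : Type v) : Type v
  | top : Formula P
  | bot : Formula P
  | var (p : P) : Formula P
  | negAt (p : P) : Formula P
  | and (φ ψ : Formula P) : Formula P
  | or (φ ψ : Formula P) : Formula P
  | dia (φ : Formula P) : Formula P
  | box (φ : Formula P) : Formula P

/-- The operators from which modal fragments are generated. -/
inductive Op : Type
  | top | bot | negAt | and | or | dia | box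

/-- `φ` is generated from propositional variables using only operators in `S`. -/
def Formula.UsesOnly {P : Type v} (S : Set Op) : Formula P → Prop
  | .top => Op.top ∈ S
  | .bot => Op.bot ∈ S
  | .var _ => True
  | .negAt _ => Op.negAt ∈ S
  | .and φ ψ => Op.and ∈ S ∧ φ.UsesOnly S ∧ ψ.UsesOnly S
  | .or φ ψ => Op.or ∈ S ∧ φ.UsesOnly S ∧ ψ.UsesOnly S
  | .dia φ => Op.dia ∈ S ∧ φ.UsesOnly S
  | .box φ => Op.box ∈ S ∧ φ.UsesOnly S

/-- The fragment of the full modal language over `P` given by the set `S` of operators. -/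
def fragment (P : Type v) (S : Set Op) : Set (Formula P) :=
  {φ | φ.UsesOnly S}

/-- The operators `□, ∧, ∨, ⊤, ⊥`. -/
def boxOps : Set Op := {Op.box, Op.and, Op.or, Op.top, Op.bot}

/-- The operators `◇, ∧, ∨, ⊤, ⊥`. -/
def diaOps : Set Op := {Op.dia, Op.and, Op.or, Op.top, Op.bot}

/-- The dual formula: every connective is replaced by its dual (`∧` and `∨`, `□` and `◇`,
`⊤` and `⊥` are exchanged), literals are left unchanged. -/
def Formula.dual {P : Type v} : Formula P → Formula P
  | .top => .bot
  | .bot => .top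
  | .var p => .var p
  | .negAt p => .negAt p
  | .and φ ψ => .or φ.dual ψ.dual
  | .or φ ψ => .and φ.dual ψ.dual
  | .dia φ => .box φ.dual
  | .box φ => .dia φ.dual

/-- A Kripke frame. -/
structure Frame : Type (u + 1) where
  World : Type u
  R : World → World → Prop

/-- A Kripke model over `P`: a frame with a colouring of its worlds by sets of variables. -/
structure Model (P : Type v) : Type (max (u + 1) v) extends Frame.{u} where
  val : World → Set P

/-- A pointed model over `P`. -/
structure PointedModel (P : Type v) : Type (max (u + 1) v) extends Model.{u, v} P where
  point : World

/-- Truth of a formula at a world of a model. -/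
def Model.Sat {P : Type v} (M : Model.{u, v} P) : M.World → Formula P → Prop
  | _, .top => True
  | _, .bot => False
  | s, .var p => p ∈ M.val s
  | s, .negAt p => p ∉ M.val s
  | s, .and φ ψ => M.Sat s φ ∧ M.Sat s ψ
  | s, .or φ ψ => M.Sat s φ ∨ M.Sat s ψ
  | s, .dia φ => ∃ t, M.R s t ∧ M.Sat t φ
  | s, .box φ => ∀ t, M.R s t → M.Sat t φ

/-- Truth of a formula at a pointed model. -/
def PointedModel.Sat {P : Type v} (E : PointedModel.{u, v} P) (φ : Formula P) : Prop :=
  E.toModel.Sat E.point φ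

/-- The pointed model obtained by flipping the colouring: each `v(t)` becomes its complement. -/
def PointedModel.flip {P : Type v} (E : PointedModel.{u, v} P) : PointedModel.{u, v} P where
  World := E.World
  R := E.R
  val := fun t => (E.val t)ᶜ
  point := E.point

/-- The class of all frames. -/
def allFrames : Set Frame.{u} := Set.univ

/-- The class of all finite frames. -/
def finiteFrames : Set Frame.{u} := {F | Finite F.World}

/-- A concept class `(X, C, ext)`: examples `X`, concepts `C`, and for each concept `c` the set
`ext c ⊆ X` of its positive examples. Only the values of `ext` on `C` matter. -/
structure ConceptClass (α : Type u) (β : Type v) where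
  X : Set α
  C : Set β
  ext : β → Set α
  ext_subset : ∀ c ∈ C, ext c ⊆ X

/-- The concept `c` fits the labelled examples `(Epos, Eneg)`. -/
def ConceptClass.Fits {α : Type u} {β : Type v} (K : ConceptClass α β)
    (Epos Eneg : Set α) (c : β) : Prop :=
  Epos ⊆ K.ext c ∧ Eneg ⊆ K.X \ K.ext c

/-- `(Epos, Eneg)` is a finite characterisation of `c` with respect to `K`: both are finite sets
of examples, `c` fits them, and every concept of `K` that fits them is equivalent to `c`. -/
structure ConceptClass.IsFiniteCharacterisation {α : Type u} {β : Type v} (K : ConceptClass α β)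
    (Epos Eneg : Set α) (c : β) : Prop where
  pos_finite : Epos.Finite
  neg_finite : Eneg.Finite
  pos_subset : Epos ⊆ K.X
  neg_subset : Eneg ⊆ K.X
  fits : K.Fits Epos Eneg c
  unique : ∀ c' ∈ K.C, K.Fits Epos Eneg c' → K.ext c' = K.ext c

/-- Every concept of `K` has a finite characterisation with respect to `K`. -/
def ConceptClass.AdmitsFiniteCharacterisations {α : Type u} {β : Type v}
    (K : ConceptClass α β) : Prop :=
  ∀ c ∈ K.C, ∃ Epos Eneg : Set α, K.IsFiniteCharacterisation Epos Eneg c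

/-- The concept class of the modal language `L` over `P` and the frame class `F`: the examples are
the pointed models over `P` based on a frame in `F`, the concepts are the formulas in `L`. -/
def modalClass {P : Type v} (F : Set Frame.{u}) (L : Set (Formula P)) :
    ConceptClass (PointedModel.{u, v} P) (Formula P) where
  X := {E | E.toFrame ∈ F}
  C := L
  ext := fun φ => {E | E.toFrame ∈ F ∧ E.Sat φ}
  ext_subset := fun _ _ _ h => h.1

/-- The Gödel number of a formula, relative to a numbering `num` of the variables. -/
def Formula.code {P : Type v} (num : P → ℕ) : Formula P → ℕ
  | .top => Nat.pair 0 0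
  | .bot => Nat.pair 1 0
  | .var p => Nat.pair 2 (num p)
  | .negAt p => Nat.pair 3 (num p)
  | .and φ ψ => Nat.pair 4 (Nat.pair (φ.code num) (ψ.code num))
  | .or φ ψ => Nat.pair 5 (Nat.pair (φ.code num) (ψ.code num))
  | .dia φ => Nat.pair 6 (φ.code num)
  | .box φ => Nat.pair 7 (φ.code num)

theorem Formula.code_injective {P : Type v} {num : P → ℕ} (hnum : Function.Injective num) :
    Function.Injective (Formula.code num) := by
  intro φ
  induction φ with
  | top => intro ψ h; cases ψ <;> simp_all [Formula.code, Nat.pair_eq_pair]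
  | bot => intro ψ h; cases ψ <;> simp_all [Formula.code, Nat.pair_eq_pair]
  | var p => intro ψ h; cases ψ <;> simp_all [Formula.code, Nat.pair_eq_pair, hnum.eq_iff]
  | negAt p => intro ψ h; cases ψ <;> simp_all [Formula.code, Nat.pair_eq_pair, hnum.eq_iff]
  | and a b iha ihb =>
    intro ψ h
    cases ψ <;> simp only [Formula.code, Nat.pair_eq_pair] at h <;>
      first | omega | exact congrArg₂ _ (iha h.2.1) (ihb h.2.2)
  | or a b iha ihb =>
    intro ψ h
    cases ψ <;> simp only [Formula.code, Nat.pair_eq_pair] at h <;>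
      first | omega | exact congrArg₂ _ (iha h.2.1) (ihb h.2.2)
  | dia a iha =>
    intro ψ h
    cases ψ <;> simp only [Formula.code, Nat.pair_eq_pair] at h <;>
      first | omega | exact congrArg _ (iha h.2)
  | box a iha =>
    intro ψ h
    cases ψ <;> simp only [Formula.code, Nat.pair_eq_pair] at h <;>
      first | omega | exact congrArg _ (iha h.2)

/-- An explicit description of a finite pointed model: `(n, edges, colours)` describes the model
with worlds `0, …, n` and distinguished world `0`, in which `R i j` holds iff `(i, j)` is listed in
`edges`, and the variable `p` is true at `i` iff `(i, num p)` is listed in `colours`. Up to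
isomorphism every finite pointed model over finitely many variables has such a description. -/
abbrev ModelCode : Type := ℕ × List (ℕ × ℕ) × List (ℕ × ℕ)

/-- The finite pointed model described by a code. -/
def ModelCode.toPointedModel {P : Type v} (num : P → ℕ) (m : ModelCode) :
    PointedModel.{u, v} P where
  World := ULift.{u} (Fin (m.1 + 1))
  R := fun i j => ((i.down : ℕ), (j.down : ℕ)) ∈ m.2.1
  val := fun i => {p | ((i.down : ℕ), num p) ∈ m.2.2}
  point := ⟨0⟩

/-- Finite characterisations with respect to `K` are effectively computable: for every numbering of
the variables there is an algorithm that outputs, given (the Gödel number of) a formula that is a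
concept of `K`, two lists of explicitly described finite pointed models which form a finite
characterisation of this formula with respect to `K`. -/
def EffectivelyCharacterisable {P : Type v}
    (K : ConceptClass (PointedModel.{u, v} P) (Formula P)) : Prop :=
  ∀ num : P → ℕ, Function.Injective num →
    ∃ f : ℕ → List ModelCode × List ModelCode, Computable f ∧
      ∀ φ ∈ K.C, K.IsFiniteCharacterisation
        {E | ∃ m ∈ (f (φ.code num)).1, E = ModelCode.toPointedModel num m}
        {E | ∃ m ∈ (f (φ.code num)).2, E = ModelCode.toPointedModel num m} φ

end ModalChar

/-! `Sim` preorders pointed models so that box formulas are preserved upwards (`Sim.sat`). For each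
box formula φ there is a finite list of models of φ such that every model of φ lies above one of
them (`CoversPos`), and a finite list of countermodels such that every countermodel lies below one
of them (`CoversNeg`). Such lists characterise φ: if ψ fits them, upward preservation carries ψ from
the first list to every model of φ, and carries its falsity from the second list down to every
countermodel (`isFiniteCharacterisation_of_covers`).

The lists arise by recursion on φ. The preorder has a least element (a loop with all variables
false), a greatest one (a dead end with all variables true), binary joins (products) and binary
meets (a fresh root over the disjoint union). Conjunction takes joins of positive and the union of
negative lists; disjunction does the opposite; a box adds a root. Graphs record false variables, so
unlisted worlds are copies of the greatest element and every construction is a finite list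
operation. The recursion runs on Gödel numbers and is primitive recursive.

Part (3) holds because flipping valuations turns truth of a box formula into falsity of its dual. -/

namespace ModalChar

universe w w'

/-! ### The simulation preorder -/

/-- `Sim M N s t`: the point `t` of `N` has at least the variables of `s`, and every successor of
`t` is matched by a successor of `s`. Formulas built with `□, ∧, ∨, ⊤, ⊥` are preserved from `s` to
`t`. -/
def Sim {P : Type v} (M : Model.{u, v} P) (N : Model.{w, v} P) (s : M.World) (t : N.World) :
    Prop :=
  ∃ Z : M.World → N.World → Prop, Z s t ∧ ∀ x y, Z x y →
    M.val x ⊆ N.val y ∧ ∀ y', N.R y y' → ∃ x', M.R x x' ∧ Z x' y'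

namespace Sim

variable {P : Type v} {M : Model.{u, v} P} {N : Model.{w, v} P} {K : Model.{w', v} P}

theorem val {s : M.World} {t : N.World} (h : Sim M N s t) : M.val s ⊆ N.val t := by
  obtain ⟨Z, hst, hZ⟩ := h
  exact (hZ s t hst).1

theorem back {s : M.World} {t : N.World} (h : Sim M N s t) {t' : N.World} (ht : N.R t t') :
    ∃ s', M.R s s' ∧ Sim M N s' t' := by
  obtain ⟨Z, hst, hZ⟩ := h
  obtain ⟨s', hs, hs'⟩ := (hZ s t hst).2 t' ht
  exact ⟨s', hs, Z, hs', hZ⟩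

/-- The union of all simulations, enlarged by one pair whose local conditions hold, is again a
simulation. -/
theorem intro {s : M.World} {t : N.World} (hv : M.val s ⊆ N.val t)
    (hb : ∀ t', N.R t t' → ∃ s', M.R s s' ∧ Sim M N s' t') : Sim M N s t := by
  refine ⟨fun x y => (x = s ∧ y = t) ∨ Sim M N x y, Or.inl ⟨rfl, rfl⟩, ?_⟩
  rintro x y (⟨rfl, rfl⟩ | h)
  · refine ⟨hv, fun t' ht => ?_⟩
    obtain ⟨s', hs, hs'⟩ := hb t' ht
    exact ⟨s', hs, Or.inr hs'⟩
  · refine ⟨h.val, fun t' ht => ?_⟩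
    obtain ⟨s', hs, hs'⟩ := h.back ht
    exact ⟨s', hs, Or.inr hs'⟩

theorem trans {s : M.World} {t : N.World} {r : K.World} (h : Sim M N s t) (h' : Sim N K t r) :
    Sim M K s r := by
  refine ⟨fun x z => ∃ y, Sim M N x y ∧ Sim N K y z, ⟨t, h, h'⟩, ?_⟩
  rintro x z ⟨y, hxy, hyz⟩
  refine ⟨hxy.val.trans hyz.val, fun z' hz => ?_⟩
  obtain ⟨y', hy, hyz'⟩ := hyz.back hz
  obtain ⟨x', hx, hxy'⟩ := hxy.back hy
  exact ⟨x', hx, y', hxy', hyz'⟩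

/-- The back condition is exactly what a box needs; diamonds and negated variables would need a
forth condition and equal valuations, and the fragment excludes both. -/
theorem sat {s : M.World} {t : N.World} (h : Sim M N s t) {φ : Formula P}
    (hφ : φ ∈ fragment P boxOps) (hs : M.Sat s φ) : N.Sat t φ := by
  induction φ generalizing s t with
  | top => trivial
  | bot => exact hs
  | var p => exact h.val hs
  | negAt p => simp [fragment, Formula.UsesOnly, boxOps] at hφ
  | and φ ψ ihφ ihψ => exact ⟨ihφ h hφ.2.1 hs.1, ihψ h hφ.2.2 hs.2⟩
  | or φ ψ ihφ ihψ => exact hs.imp (ihφ h hφ.2.1) (ihψ h hφ.2.2)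
  | dia φ ih => simp [fragment, Formula.UsesOnly, boxOps] at hφ
  | box φ ih =>
    intro t' ht
    obtain ⟨s', hs', hst⟩ := h.back ht
    exact ih hst hφ.2 (hs s' hs')

end Sim

/-! ### Finite graphs: bounds in the simulation preorder -/

/-- A finite graph on `ℕ` with distinguished point `0`, together with the finite list of pairs
`(i, k)` such that the variable with number `k` is false at `i`. -/
abbrev PointedGraph : Type := List (ℕ × ℕ) × List (ℕ × ℕ)

namespace PointedGraph

/-- The model on `ℕ` described by a graph. -/
def model {P : Type v} (num : P → ℕ) (e : PointedGraph) : Model.{0, v} P where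
  World := ℕ
  R := fun i j => (i, j) ∈ e.1
  val := fun i => {p | (i, num p) ∉ e.2}

/-- The name of the world `i` of the component `e` in a disjoint union of graphs. -/
def tag (e : PointedGraph) (i : ℕ) : ℕ := Nat.pair (Encodable.encode e) i + 1

theorem tag_inj {e e' : PointedGraph} {i i' : ℕ} : tag e i = tag e' i' ↔ e = e' ∧ i = i' := by
  simp [tag, Nat.pair_eq_pair]

theorem tag_ne_zero (e : PointedGraph) (i : ℕ) : tag e i ≠ 0 := Nat.succ_ne_zero _

/-- The disjoint union of the graphs in `L` and a new distinguished point `0`, at which the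
variables `ns` are false and whose successors are `rs`. -/
def node (ns rs : List ℕ) (L : List PointedGraph) : PointedGraph :=
  (rs.map (fun j => (0, j)) ++ L.flatMap (fun e => e.1.map (fun x => (tag e x.1, tag e x.2))),
    ns.map (fun k => (0, k)) ++ L.flatMap (fun e => e.2.map (fun x => (tag e x.1, x.2))))

/-- A new distinguished point whose successors are the distinguished points of the graphs in
`L`. -/
def cone (ns : List ℕ) (L : List PointedGraph) : PointedGraph := node ns (L.map fun e => tag e 0) L

/-- The successors of the distinguished point. -/
def rootSucc (e : PointedGraph) : List ℕ := e.1.flatMap fun x => if x.1 = 0 then [x.2] else []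

/-- The variables that are false at the distinguished point. -/
def rootFalse (e : PointedGraph) : List ℕ := e.2.flatMap fun x => if x.1 = 0 then [x.2] else []

/-- A greatest lower bound of the distinguished points of two graphs with respect to `Sim`. -/
def meet (e e' : PointedGraph) : PointedGraph :=
  node (rootFalse e ++ rootFalse e') ((rootSucc e).map (tag e) ++ (rootSucc e').map (tag e'))
    [e, e']

/-- A least upper bound of the distinguished points of two graphs with respect to `Sim`. -/
def join (e e' : PointedGraph) : PointedGraph :=
  (e.1.flatMap fun x => e'.1.map fun y => (Nat.pair x.1 y.1, Nat.pair x.2 y.2),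
    e.2.flatMap fun x => e'.2.flatMap fun y => if x.2 = y.2 then [(Nat.pair x.1 y.1, x.2)] else [])

/-- A reflexive point at which the variables `ps` are false. -/
def loop (ps : List ℕ) : PointedGraph := ([(0, 0)], ps.map fun k => (0, k))

theorem mem_rootSucc {e : PointedGraph} {j : ℕ} : j ∈ rootSucc e ↔ (0, j) ∈ e.1 := by
  simp only [rootSucc, List.mem_flatMap]
  constructor
  · rintro ⟨⟨a, b⟩, hx, h⟩
    split_ifs at h with h0 <;> simp_all
  · exact fun h => ⟨_, h, by simp⟩

theorem mem_rootFalse {e : PointedGraph} {k : ℕ} : k ∈ rootFalse e ↔ (0, k) ∈ e.2 := by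
  simp only [rootFalse, List.mem_flatMap]
  constructor
  · rintro ⟨⟨a, b⟩, hx, h⟩
    split_ifs at h with h0 <;> simp_all
  · exact fun h => ⟨_, h, by simp⟩

variable {P : Type v} {num : P → ℕ} {ns rs : List ℕ} {L : List PointedGraph} {e e' : PointedGraph}

theorem node_edge_zero {y : ℕ} : (0, y) ∈ (node ns rs L).1 ↔ y ∈ rs := by
  simp [node, (tag_ne_zero _ _)]

theorem node_false_zero {k : ℕ} : (0, k) ∈ (node ns rs L).2 ↔ k ∈ ns := by
  simp [node, (tag_ne_zero _ _)]

theorem node_edge_tag (he : e ∈ L) {i y : ℕ} :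
    (tag e i, y) ∈ (node ns rs L).1 ↔ ∃ j, y = tag e j ∧ (i, j) ∈ e.1 := by
  simp only [node, List.mem_append, List.mem_map, List.mem_flatMap, Prod.mk.injEq]
  constructor
  · rintro (⟨j, -, h, -⟩ | ⟨e', -, ⟨a, b⟩, hx, h, rfl⟩)
    · exact absurd h.symm (tag_ne_zero _ _)
    · obtain ⟨rfl, rfl⟩ := tag_inj.1 h
      exact ⟨b, rfl, hx⟩
  · rintro ⟨j, rfl, h⟩
    exact Or.inr ⟨e, he, _, h, rfl, rfl⟩

theorem node_false_tag (he : e ∈ L) {i k : ℕ} :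
    (tag e i, k) ∈ (node ns rs L).2 ↔ (i, k) ∈ e.2 := by
  simp only [node, List.mem_append, List.mem_map, List.mem_flatMap, Prod.mk.injEq]
  constructor
  · rintro (⟨j, -, h, -⟩ | ⟨e', -, ⟨a, b⟩, hx, h, rfl⟩)
    · exact absurd h.symm (tag_ne_zero _ _)
    · obtain ⟨rfl, rfl⟩ := tag_inj.1 h
      exact hx
  · intro h
    exact Or.inr ⟨e, he, _, h, rfl, rfl⟩

/-- No edge leaves a tagged component, so the component is a generated submodel; with the next
lemma, tagging changes nothing up to `Sim` in both directions. -/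
theorem sim_node_tag (he : e ∈ L) (i : ℕ) :
    Sim (e.model num) ((node ns rs L).model num) i (tag e i) := by
  refine ⟨fun x y => y = tag e x, rfl, ?_⟩
  rintro x _ rfl
  refine ⟨fun p hp h => hp ((node_false_tag he).1 h), fun y' hy => ?_⟩
  obtain ⟨j, rfl, hj⟩ := (node_edge_tag he).1 hy
  exact ⟨j, hj, rfl⟩

theorem sim_tag_node (he : e ∈ L) (i : ℕ) :
    Sim ((node ns rs L).model num) (e.model num) (tag e i) i := by
  refine ⟨fun x y => x = tag e y, rfl, ?_⟩
  rintro _ y rfl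
  refine ⟨fun p hp h => hp ((node_false_tag he).2 h), fun y' hy => ?_⟩
  exact ⟨tag e y', (node_edge_tag he).2 ⟨y', rfl, hy⟩, rfl⟩

theorem cone_edge_zero {y : ℕ} : (0, y) ∈ (cone ns L).1 ↔ ∃ e ∈ L, y = tag e 0 := by
  simp [cone, node_edge_zero, eq_comm]

theorem sim_cone {M : Model.{u, v} P} {s : M.World} (hv : ∀ p, num p ∉ ns → p ∈ M.val s)
    (hs : ∀ t, M.R s t → ∃ e ∈ L, Sim (e.model num) M (0 : ℕ) t) :
    Sim ((cone ns L).model num) M (0 : ℕ) s := by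
  refine Sim.intro (fun p hp => hv p fun h => hp (node_false_zero.2 h)) fun t ht => ?_
  obtain ⟨e, he, h⟩ := hs t ht
  exact ⟨tag e 0, cone_edge_zero.2 ⟨e, he, rfl⟩, (sim_tag_node he 0).trans h⟩

theorem sim_of_cone {M : Model.{u, v} P} {s : M.World} (hv : ∀ p ∈ M.val s, num p ∉ ns)
    (hs : ∀ e ∈ L, ∃ t, M.R s t ∧ Sim M (e.model num) t (0 : ℕ)) :
    Sim M ((cone ns L).model num) s (0 : ℕ) := by
  refine Sim.intro (fun p hp h => hv p hp (node_false_zero.1 h)) fun t ht => ?_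
  obtain ⟨e, he, rfl⟩ := cone_edge_zero.1 ht
  obtain ⟨t, ht, h⟩ := hs e he
  exact ⟨t, ht, h.trans (sim_node_tag he 0)⟩

/-- More false variables and more successors only make a point smaller. The root of the meet is a
fresh world, since the old roots may have incoming edges. -/
theorem sim_meet_left : Sim ((meet e e').model num) (e.model num) (0 : ℕ) (0 : ℕ) := by
  refine Sim.intro (fun p hp h => hp ?_) fun t ht => ?_
  · exact node_false_zero.2 (List.mem_append_left _ (mem_rootFalse.2 h))
  · exact ⟨tag e t, node_edge_zero.2 (List.mem_append_left _
      (List.mem_map_of_mem (mem_rootSucc.2 ht))), sim_tag_node (by simp) t⟩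

theorem sim_meet_right : Sim ((meet e e').model num) (e'.model num) (0 : ℕ) (0 : ℕ) := by
  refine Sim.intro (fun p hp h => hp ?_) fun t ht => ?_
  · exact node_false_zero.2 (List.mem_append_right _ (mem_rootFalse.2 h))
  · exact ⟨tag e' t, node_edge_zero.2 (List.mem_append_right _
      (List.mem_map_of_mem (mem_rootSucc.2 ht))), sim_tag_node (by simp) t⟩

theorem sim_meet {M : Model.{u, v} P} {s : M.World} (h : Sim M (e.model num) s (0 : ℕ))
    (h' : Sim M (e'.model num) s (0 : ℕ)) : Sim M ((meet e e').model num) s (0 : ℕ) := by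
  refine Sim.intro (fun p hp hk => ?_) fun t ht => ?_
  · rcases List.mem_append.1 (node_false_zero.1 hk) with hk | hk
    · exact h.val hp (mem_rootFalse.1 hk)
    · exact h'.val hp (mem_rootFalse.1 hk)
  · rcases List.mem_append.1 (node_edge_zero.1 ht) with ht | ht
    · obtain ⟨j, hj, rfl⟩ := List.mem_map.1 ht
      obtain ⟨s', hs, hsim⟩ := h.back (t' := j) (mem_rootSucc.1 hj)
      exact ⟨s', hs, hsim.trans (sim_node_tag (by simp) j)⟩
    · obtain ⟨j, hj, rfl⟩ := List.mem_map.1 ht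
      obtain ⟨s', hs, hsim⟩ := h'.back (t' := j) (mem_rootSucc.1 hj)
      exact ⟨s', hs, hsim.trans (sim_node_tag (by simp) j)⟩

theorem exists_unpair (a b : ℕ) : ∃ c : ℕ, c.unpair.1 = a ∧ c.unpair.2 = b :=
  ⟨Nat.pair a b, by simp, by simp⟩

theorem join_edge {x y : ℕ} : (x, y) ∈ (join e e').1 ↔
    (x.unpair.1, y.unpair.1) ∈ e.1 ∧ (x.unpair.2, y.unpair.2) ∈ e'.1 := by
  simp only [join, List.mem_flatMap, List.mem_map, Prod.mk.injEq]
  constructor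
  · rintro ⟨a, ha, b, hb, rfl, rfl⟩
    simpa using ⟨ha, hb⟩
  · rintro ⟨h, h'⟩
    exact ⟨_, h, _, h', by simp, by simp⟩

theorem join_false {x k : ℕ} : (x, k) ∈ (join e e').2 ↔
    (x.unpair.1, k) ∈ e.2 ∧ (x.unpair.2, k) ∈ e'.2 := by
  simp only [join, List.mem_flatMap]
  constructor
  · rintro ⟨⟨a, i⟩, ha, ⟨b, j⟩, hb, h⟩
    split_ifs at h with h0
    · simp only [List.mem_singleton, Prod.mk.injEq] at h
      obtain ⟨rfl, rfl⟩ := h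
      obtain rfl : k = j := h0
      simpa using ⟨ha, hb⟩
    · simp at h
  · rintro ⟨h, h'⟩
    exact ⟨_, h, _, h', by simp⟩

/-- The projection of the product is a simulation; the roots match because `0` unpairs to `(0, 0)`.
-/
theorem sim_join_left : Sim (e.model num) ((join e e').model num) (0 : ℕ) (0 : ℕ) := by
  refine ⟨fun x (y : ℕ) => y.unpair.1 = x, by simp, ?_⟩
  rintro _ (y : ℕ) rfl
  exact ⟨fun p hp h => hp (join_false.1 h).1, fun y' hy => ⟨_, (join_edge.1 hy).1, rfl⟩⟩

theorem sim_join_right : Sim (e'.model num) ((join e e').model num) (0 : ℕ) (0 : ℕ) := by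
  refine ⟨fun x (y : ℕ) => y.unpair.2 = x, by simp, ?_⟩
  rintro _ (y : ℕ) rfl
  exact ⟨fun p hp h => hp (join_false.1 h).2, fun y' hy => ⟨_, (join_edge.1 hy).2, rfl⟩⟩

theorem sim_join {M : Model.{u, v} P} {s : M.World} (h : Sim (e.model num) M (0 : ℕ) s)
    (h' : Sim (e'.model num) M (0 : ℕ) s) : Sim ((join e e').model num) M (0 : ℕ) s := by
  refine ⟨fun (x : ℕ) y => Sim (e.model num) M x.unpair.1 y ∧ Sim (e'.model num) M x.unpair.2 y,
    by simpa using ⟨h, h'⟩, ?_⟩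
  rintro (x : ℕ) y ⟨hx, hx'⟩
  refine ⟨fun p hp => ?_, fun y' hy => ?_⟩
  -- A variable is true at a pair as soon as it is true at one coordinate.
  · by_cases hk : (x.unpair.1, num p) ∈ e.2
    · exact hx'.val fun hk' => hp (join_false.2 ⟨hk, hk'⟩)
    · exact hx.val hk
  · obtain ⟨a, ha, hs⟩ := hx.back hy
    obtain ⟨b, hb, hs'⟩ := hx'.back hy
    obtain ⟨c, rfl, rfl⟩ := exists_unpair a b
    exact ⟨c, join_edge.2 ⟨ha, hb⟩, hs, hs'⟩

/-- The loop is a least element: nothing is true at it, and it answers every successor with itself.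
-/
theorem sim_loop {ps : List ℕ} (hps : ∀ p, num p ∈ ps) {M : Model.{u, v} P} (s : M.World) :
    Sim ((loop ps).model num) M (0 : ℕ) s := by
  refine ⟨fun x _ => x = (0 : ℕ), rfl, ?_⟩
  rintro _ y rfl
  refine ⟨fun p hp => absurd ?_ hp, fun _ _ => ⟨(0 : ℕ), ?_, rfl⟩⟩
  · exact List.mem_map.2 ⟨_, hps p, rfl⟩
  · exact List.mem_singleton.2 rfl

end PointedGraph

/-! ### Finite covers of the models and countermodels of a formula -/

/-- `L` consists of models of `φ`, and every model of `φ` is above one of them. -/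
def CoversPos {P : Type v} (num : P → ℕ) (L : List PointedGraph) (φ : Formula P) : Prop :=
  (∀ e ∈ L, (e.model num).Sat (0 : ℕ) φ) ∧ ∀ (M : Model.{u, v} P) (s : M.World), M.Sat s φ →
    ∃ e ∈ L, Sim (e.model num) M (0 : ℕ) s

/-- `L` consists of countermodels of `φ`, and every countermodel of `φ` is below one of them. -/
def CoversNeg {P : Type v} (num : P → ℕ) (L : List PointedGraph) (φ : Formula P) : Prop :=
  (∀ e ∈ L, ¬ (e.model num).Sat (0 : ℕ) φ) ∧ ∀ (M : Model.{u, v} P) (s : M.World), ¬ M.Sat s φ →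
    ∃ e ∈ L, Sim M (e.model num) s (0 : ℕ)

open PointedGraph

/-- The numbers in `ps` other than `k`. -/
def others (ps : List ℕ) (k : ℕ) : List ℕ := ps.flatMap fun j => if j = k then [] else [j]

theorem mem_others {ps : List ℕ} {j k : ℕ} : j ∈ others ps k ↔ j ∈ ps ∧ j ≠ k := by
  simp only [others, List.mem_flatMap]
  constructor
  · rintro ⟨a, ha, h⟩
    split_ifs at h with h0 <;> simp_all
  · rintro ⟨h, h'⟩
    exact ⟨j, h, by simp [h']⟩

section Covers

variable {P : Type v} {num : P → ℕ} {ps : List ℕ} {L L' : List PointedGraph} {φ ψ : Formula P}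

theorem coversPos_top (hps : ∀ p, num p ∈ ps) :
    CoversPos.{u, v} num [loop ps] (Formula.top : Formula P) :=
  ⟨fun _ _ => trivial, fun _ s _ => ⟨_, List.mem_singleton.2 rfl, sim_loop hps s⟩⟩

theorem coversNeg_top : CoversNeg.{u, v} num [] (Formula.top : Formula P) :=
  ⟨by simp, fun _ _ h => absurd trivial h⟩

theorem coversPos_bot : CoversPos.{u, v} num [] (Formula.bot : Formula P) :=
  ⟨by simp, fun _ _ h => h.elim⟩

/-- With no variable listed as false and no edges, the cone is the greatest element. -/
theorem coversNeg_bot : CoversNeg.{u, v} num [cone [] []] (Formula.bot : Formula P) :=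
  ⟨fun _ _ h => h, fun _ _ _ => ⟨_, List.mem_singleton.2 rfl, sim_of_cone (by simp) (by simp)⟩⟩

/-- The smallest point satisfying a variable makes all others false and sees a least element. -/
theorem coversPos_var (hnum : Function.Injective num) (hps : ∀ p, num p ∈ ps) (p : P) :
    CoversPos.{u, v} num [cone (others ps (num p)) [loop ps]] (Formula.var p) := by
  refine ⟨fun e he => ?_, fun M s hs => ⟨_, List.mem_singleton.2 rfl, sim_cone ?_ ?_⟩⟩
  · obtain rfl := List.mem_singleton.1 he
    exact fun h => (mem_others.1 (node_false_zero.1 h)).2 rfl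
  · intro q hq
    by_cases h : num q = num p
    · exact hnum h ▸ hs
    · exact absurd (mem_others.2 ⟨hps q, h⟩) hq
  · exact fun t _ => ⟨_, List.mem_singleton.2 rfl, sim_loop hps t⟩

theorem coversNeg_var (hnum : Function.Injective num) (p : P) :
    CoversNeg.{u, v} num [cone [num p] []] (Formula.var p) := by
  refine ⟨fun e he h => ?_, fun M s hs => ⟨_, List.mem_singleton.2 rfl, sim_of_cone ?_ (by simp)⟩⟩
  · obtain rfl := List.mem_singleton.1 he
    exact h (node_false_zero.2 (List.mem_singleton.2 rfl))
  · intro q hq h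
    exact hs (hnum (List.mem_singleton.1 h) ▸ hq)

/-- An intersection of two principal up-sets is the up-set of a join. -/
theorem CoversPos.and (hφ : φ ∈ fragment P boxOps) (hψ : ψ ∈ fragment P boxOps)
    (h : CoversPos.{u, v} num L φ) (h' : CoversPos.{u, v} num L' ψ) :
    CoversPos.{u, v} num (L.flatMap fun e => L'.map fun e' => join e e') (φ.and ψ) := by
  refine ⟨fun e he => ?_, fun M s hs => ?_⟩
  · obtain ⟨a, ha, he⟩ := List.mem_flatMap.1 he
    obtain ⟨b, hb, rfl⟩ := List.mem_map.1 he
    exact ⟨sim_join_left.sat hφ (h.1 a ha), sim_join_right.sat hψ (h'.1 b hb)⟩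
  · obtain ⟨a, ha, hs1⟩ := h.2 M s hs.1
    obtain ⟨b, hb, hs2⟩ := h'.2 M s hs.2
    exact ⟨_, List.mem_flatMap.2 ⟨a, ha, List.mem_map.2 ⟨b, hb, rfl⟩⟩, sim_join hs1 hs2⟩

theorem CoversNeg.and (h : CoversNeg.{u, v} num L φ) (h' : CoversNeg.{u, v} num L' ψ) :
    CoversNeg.{u, v} num (L ++ L') (φ.and ψ) := by
  refine ⟨fun e he hs => ?_, fun M s hs => ?_⟩
  · rcases List.mem_append.1 he with he | he
    · exact h.1 e he hs.1
    · exact h'.1 e he hs.2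
  · by_cases hs1 : M.Sat s φ
    · obtain ⟨e, he, hsim⟩ := h'.2 M s fun hs2 => hs ⟨hs1, hs2⟩
      exact ⟨e, List.mem_append_right _ he, hsim⟩
    · obtain ⟨e, he, hsim⟩ := h.2 M s hs1
      exact ⟨e, List.mem_append_left _ he, hsim⟩

theorem CoversPos.or (h : CoversPos.{u, v} num L φ) (h' : CoversPos.{u, v} num L' ψ) :
    CoversPos.{u, v} num (L ++ L') (φ.or ψ) := by
  refine ⟨fun e he => (List.mem_append.1 he).imp (h.1 e) (h'.1 e), fun M s hs => ?_⟩
  rcases hs with hs | hs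
  · obtain ⟨e, he, hsim⟩ := h.2 M s hs
    exact ⟨e, List.mem_append_left _ he, hsim⟩
  · obtain ⟨e, he, hsim⟩ := h'.2 M s hs
    exact ⟨e, List.mem_append_right _ he, hsim⟩

/-- Countermodels of a disjunction form an intersection of down-sets, so meets cover them. -/
theorem CoversNeg.or (hφ : φ ∈ fragment P boxOps) (hψ : ψ ∈ fragment P boxOps)
    (h : CoversNeg.{u, v} num L φ) (h' : CoversNeg.{u, v} num L' ψ) :
    CoversNeg.{u, v} num (L.flatMap fun e => L'.map fun e' => meet e e') (φ.or ψ) := by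
  refine ⟨fun e he => ?_, fun M s hs => ?_⟩
  · obtain ⟨a, ha, he⟩ := List.mem_flatMap.1 he
    obtain ⟨b, hb, rfl⟩ := List.mem_map.1 he
    rintro (hs | hs)
    · exact h.1 a ha (sim_meet_left.sat hφ hs)
    · exact h'.1 b hb (sim_meet_right.sat hψ hs)
  · obtain ⟨a, ha, hs1⟩ := h.2 M s fun hs' => hs (Or.inl hs')
    obtain ⟨b, hb, hs2⟩ := h'.2 M s fun hs' => hs (Or.inr hs')
    exact ⟨_, List.mem_flatMap.2 ⟨a, ha, List.mem_map.2 ⟨b, hb, rfl⟩⟩, sim_meet hs1 hs2⟩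

/-- A single model suffices: one root with all variables false sees every minimal model of φ at
once, and a successor of any other model of the box is matched by one of these. -/
theorem CoversPos.box (hφ : φ ∈ fragment P boxOps) (hps : ∀ p, num p ∈ ps)
    (h : CoversPos.{u, v} num L φ) : CoversPos.{u, v} num [cone ps L] φ.box := by
  refine ⟨fun e he => ?_, fun M s hs => ⟨_, List.mem_singleton.2 rfl, sim_cone ?_ ?_⟩⟩
  · obtain rfl := List.mem_singleton.1 he
    intro t ht
    obtain ⟨e, he, rfl⟩ := cone_edge_zero.1 ht
    exact (sim_node_tag he 0).sat hφ (h.1 e he)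
  · exact fun p hp => absurd (hps p) hp
  · exact fun t ht => h.2 M t (hs t ht)

/-- One failing successor refutes a box, and a point with a single successor and all variables true
is as large as possible. -/
theorem CoversNeg.box (hφ : φ ∈ fragment P boxOps) (h : CoversNeg.{u, v} num L φ) :
    CoversNeg.{u, v} num (L.map fun e => cone [] [e]) φ.box := by
  refine ⟨fun e he hs => ?_, fun M s hs => ?_⟩
  · obtain ⟨a, ha, rfl⟩ := List.mem_map.1 he
    have ha' : a ∈ [a] := List.mem_singleton.2 rfl
    exact h.1 a ha ((sim_tag_node ha' 0).sat hφ (hs _ (cone_edge_zero.2 ⟨a, ha', rfl⟩)))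
  · have hs' : ∃ t, M.R s t ∧ ¬ M.Sat t φ := by
      by_contra hcon
      push Not at hcon
      exact hs hcon
    obtain ⟨t, ht, hsat⟩ := hs'
    obtain ⟨e, he, hsim⟩ := h.2 M t hsat
    refine ⟨_, List.mem_map.2 ⟨e, he, rfl⟩, sim_of_cone (by simp) ?_⟩
    intro e' he'
    obtain rfl := List.mem_singleton.1 he'
    exact ⟨t, ht, hsim⟩

end Covers

/-! ### From graphs on `ℕ` to codes of finite models -/

namespace PointedGraph

/-- An upper bound of the targets of the edges of a graph. -/
def bound (e : PointedGraph) : ℕ := e.1.foldr (fun x s => x.2 + s) 0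

theorem le_bound {e : PointedGraph} {x : ℕ × ℕ} (hx : x ∈ e.1) : x.2 ≤ e.bound := by
  obtain ⟨l, l'⟩ := e
  change x.2 ≤ l.foldr (fun x s => x.2 + s) 0
  change x ∈ l at hx
  induction l with
  | nil => simp at hx
  | cons a l ih =>
    rcases List.mem_cons.1 hx with rfl | hx
    · simp
    · exact (ih hx).trans (by simp)

/-- The code of the model described by a graph, restricted to the worlds `0, …, e.bound`. -/
def toCode (ps : List ℕ) (e : PointedGraph) : ModelCode :=
  (e.bound, e.1, (List.range (e.bound + 1)).flatMap fun i =>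
    ps.flatMap fun k => if ∃ x ∈ e.2, x = (i, k) then [] else [(i, k)])

theorem mem_toCode_colours {ps : List ℕ} {e : PointedGraph} {i k : ℕ} :
    (i, k) ∈ (toCode ps e).2.2 ↔ i ≤ e.bound ∧ k ∈ ps ∧ (i, k) ∉ e.2 := by
  simp only [toCode, List.mem_flatMap, List.mem_range, exists_eq_right]
  constructor
  · rintro ⟨j, hj, l, hl, h⟩
    split_ifs at h with h0
    · simp at h
    · simp only [List.mem_singleton, Prod.mk.injEq] at h
      obtain ⟨rfl, rfl⟩ := h
      exact ⟨Nat.lt_succ_iff.1 hj, hl, h0⟩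
  · rintro ⟨hi, hk, h⟩
    exact ⟨i, Nat.lt_succ_iff.2 hi, k, hk, by simp [h]⟩

section

variable {P : Type v} {num : P → ℕ} {ps : List ℕ}

/-- The worlds up to `bound` contain the root and every edge target, so cutting off the rest loses
no successor. -/
theorem toCode_sim (e : PointedGraph) :
    Sim ((toCode ps e).toPointedModel num : PointedModel.{u, v} P).toModel (e.model num)
      ((toCode ps e).toPointedModel num : PointedModel.{u, v} P).point (0 : ℕ) := by
  refine ⟨fun x y => y = (x.down : ℕ), rfl, ?_⟩
  rintro x _ rfl
  refine ⟨fun p hp => (mem_toCode_colours.1 hp).2.2, fun y hy => ?_⟩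
  exact ⟨⟨⟨y, Nat.lt_succ_iff.2 (le_bound hy)⟩⟩, hy, rfl⟩

theorem sim_toCode (hps : ∀ p, num p ∈ ps) (e : PointedGraph) :
    Sim (e.model num) ((toCode ps e).toPointedModel num : PointedModel.{u, v} P).toModel
      (0 : ℕ) ((toCode ps e).toPointedModel num : PointedModel.{u, v} P).point := by
  refine ⟨fun x y => x = (y.down : ℕ), rfl, ?_⟩
  rintro _ y rfl
  refine ⟨fun p hp => mem_toCode_colours.2 ⟨Nat.lt_succ_iff.1 y.down.2, hps p, hp⟩, ?_⟩
  exact fun y' hy => ⟨_, hy, rfl⟩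

end

end PointedGraph

/-! ### Covers give characterisations -/

theorem isFiniteCharacterisation_of_covers {P : Type v} {num : P → ℕ} {ps : List ℕ}
    (hps : ∀ p, num p ∈ ps) {F : Set Frame.{u}} (hF : finiteFrames ⊆ F) {L L' : List PointedGraph}
    {φ : Formula P} (hφ : φ ∈ fragment P boxOps) (h : CoversPos.{u, v} num L φ)
    (h' : CoversNeg.{u, v} num L' φ) :
    (modalClass F (fragment P boxOps)).IsFiniteCharacterisation
      {E | ∃ m ∈ L.map (toCode ps), E = ModelCode.toPointedModel num m}
      {E | ∃ m ∈ L'.map (toCode ps), E = ModelCode.toPointedModel num m} φ := by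
  have hfin : ∀ l : List ModelCode,
      {E : PointedModel.{u, v} P | ∃ m ∈ l, E = ModelCode.toPointedModel num m}.Finite := by
    intro l
    refine (l.finite_toSet.image (ModelCode.toPointedModel num)).subset ?_
    rintro _ ⟨m, hm, rfl⟩
    exact ⟨m, hm, rfl⟩
  have hX : ∀ m : ModelCode, (ModelCode.toPointedModel num m : PointedModel.{u, v} P).toFrame ∈ F :=
    fun m => hF (inferInstanceAs (Finite (ULift.{u} (Fin (m.1 + 1)))))
  refine ⟨hfin _, hfin _, ?_, ?_, ⟨?_, ?_⟩, ?_⟩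
  · rintro _ ⟨m, -, rfl⟩
    exact hX m
  · rintro _ ⟨m, -, rfl⟩
    exact hX m
  · rintro _ ⟨m, hm, rfl⟩
    obtain ⟨e, he, rfl⟩ := List.mem_map.1 hm
    exact ⟨hX _, (sim_toCode hps e).sat hφ (h.1 e he)⟩
  · rintro _ ⟨m, hm, rfl⟩
    obtain ⟨e, he, rfl⟩ := List.mem_map.1 hm
    exact ⟨hX _, fun hs => h'.1 e he ((toCode_sim e).sat hφ hs.2)⟩
  · rintro ψ hψ ⟨hp, hn⟩
    ext E
    refine ⟨fun hE => ⟨hE.1, ?_⟩, fun hE => ⟨hE.1, ?_⟩⟩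
    · by_contra hs
      -- A point satisfying ψ but not φ lies below a negative example, which would then satisfy ψ.
      obtain ⟨e, he, hsim⟩ := h'.2 E.toModel E.point hs
      exact (hn ⟨_, List.mem_map.2 ⟨e, he, rfl⟩, rfl⟩).2
        ⟨hX _, (hsim.trans (sim_toCode hps e)).sat hψ hE.2⟩
    · obtain ⟨e, he, hsim⟩ := h.2 E.toModel E.point hE.2
      exact ((toCode_sim e).trans hsim).sat hψ (hp ⟨_, List.mem_map.2 ⟨e, he, rfl⟩, rfl⟩).2

/-! ### Course-of-values recursion on Gödel numbers -/

/-- The positive and the negative graphs for the formula with code `n`, given those for the formulas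
with codes below `n`. -/
def coverStep (ps : List ℕ) (n : ℕ) (H : List (List PointedGraph × List PointedGraph)) :
    List PointedGraph × List PointedGraph :=
  if n.unpair.1 = 0 then ([loop ps], [])
  else if n.unpair.1 = 1 then ([], [cone [] []])
  else if n.unpair.1 = 2 then ([cone (others ps n.unpair.2) [loop ps]], [cone [n.unpair.2] []])
  else if n.unpair.1 = 4 then
    ((H.getD n.unpair.2.unpair.1 ([], [])).1.flatMap fun e =>
        (H.getD n.unpair.2.unpair.2 ([], [])).1.map fun e' => join e e',
      (H.getD n.unpair.2.unpair.1 ([], [])).2 ++ (H.getD n.unpair.2.unpair.2 ([], [])).2)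
  else if n.unpair.1 = 5 then
    ((H.getD n.unpair.2.unpair.1 ([], [])).1 ++ (H.getD n.unpair.2.unpair.2 ([], [])).1,
      (H.getD n.unpair.2.unpair.1 ([], [])).2.flatMap fun e =>
        (H.getD n.unpair.2.unpair.2 ([], [])).2.map fun e' => meet e e')
  else ([cone ps (H.getD n.unpair.2 ([], [])).1],
    (H.getD n.unpair.2 ([], [])).2.map fun e => cone [] [e])

/-- The values of `cover` below `n`. -/
def coverTable (ps : List ℕ) (n : ℕ) : List (List PointedGraph × List PointedGraph) :=
  Nat.rec [] (fun k H => H ++ [coverStep ps k H]) n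

/-- The positive and the negative graphs for the formula with code `n`. -/
def cover (ps : List ℕ) (n : ℕ) : List PointedGraph × List PointedGraph :=
  coverStep ps n (coverTable ps n)

theorem coverTable_eq (ps : List ℕ) (n : ℕ) : coverTable ps n = (List.range n).map (cover ps) := by
  induction n with
  | zero => rfl
  | succ n ih =>
    rw [List.range_succ, List.map_append, ← ih]
    rfl

theorem coverTable_getD (ps : List ℕ) {n k : ℕ} (h : k < n) :
    (coverTable ps n).getD k ([], []) = cover ps k := by
  rw [coverTable_eq, List.getD_eq_getElem?_getD]
  simp [h]

/-- Constructor tags of compound formulas are positive, which makes subformula codes strictly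
smaller; for tag `0` this fails, as `Nat.pair 0 0 = 0`. -/
theorem lt_pair_right_of_pos {a : ℕ} (ha : 0 < a) (b : ℕ) : b < Nat.pair a b := by
  unfold Nat.pair
  split_ifs with h <;> nlinarith

/-- Subformula codes lie inside the table, so the default `([], [])` is never read; codes with the
tags of `negAt` and `dia` get junk values, which do not matter here. -/
theorem cover_code {P : Type v} {num : P → ℕ} (hnum : Function.Injective num) {ps : List ℕ}
    (hps : ∀ p, num p ∈ ps) {φ : Formula P} (hφ : φ ∈ fragment P boxOps) :
    CoversPos.{u, v} num (cover ps (φ.code num)).1 φ ∧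
      CoversNeg.{u, v} num (cover ps (φ.code num)).2 φ := by
  have key : ∀ {t a b : ℕ}, 0 < t → a < Nat.pair t (Nat.pair a b) ∧ b < Nat.pair t (Nat.pair a b) :=
    fun {t a b} ht => ⟨(Nat.left_le_pair a b).trans_lt (lt_pair_right_of_pos ht _),
      (Nat.right_le_pair a b).trans_lt (lt_pair_right_of_pos ht _)⟩
  induction φ with
  | top =>
    simp only [cover, coverStep, Formula.code, Nat.unpair_pair]
    exact ⟨coversPos_top hps, coversNeg_top⟩
  | bot =>
    simp only [cover, coverStep, Formula.code, Nat.unpair_pair]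
    exact ⟨coversPos_bot, coversNeg_bot⟩
  | var p =>
    simp only [cover, coverStep, Formula.code, Nat.unpair_pair]
    exact ⟨coversPos_var hnum hps p, coversNeg_var hnum p⟩
  | negAt p => simp [fragment, Formula.UsesOnly, boxOps] at hφ
  | and φ ψ ihφ ihψ =>
    simp only [cover, coverStep, Formula.code, Nat.unpair_pair]
    rw [coverTable_getD ps (key (by norm_num)).1, coverTable_getD ps (key (by norm_num)).2]
    exact ⟨(ihφ hφ.2.1).1.and hφ.2.1 hφ.2.2 (ihψ hφ.2.2).1, (ihφ hφ.2.1).2.and (ihψ hφ.2.2).2⟩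
  | or φ ψ ihφ ihψ =>
    simp only [cover, coverStep, Formula.code, Nat.unpair_pair]
    rw [coverTable_getD ps (key (by norm_num)).1, coverTable_getD ps (key (by norm_num)).2]
    exact ⟨(ihφ hφ.2.1).1.or (ihψ hφ.2.2).1, (ihφ hφ.2.1).2.or hφ.2.1 hφ.2.2 (ihψ hφ.2.2).2⟩
  | dia φ ih => simp [fragment, Formula.UsesOnly, boxOps] at hφ
  | box φ ih =>
    simp only [cover, coverStep, Formula.code, Nat.unpair_pair]
    rw [coverTable_getD ps (lt_pair_right_of_pos (by norm_num) _)]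
    exact ⟨(ih hφ.2).1.box hφ.2 hps, (ih hφ.2).2.box hφ.2⟩

/-! ### Duality between the box and diamond fragments -/

section Duality

variable {P : Type v}

theorem Formula.dual_dual (φ : Formula P) : φ.dual.dual = φ := by
  induction φ <;> simp_all [Formula.dual]

theorem dual_mem_diaOps {φ : Formula P} :
    φ.dual ∈ fragment P diaOps ↔ φ ∈ fragment P boxOps := by
  change φ.dual.UsesOnly diaOps ↔ φ.UsesOnly boxOps
  induction φ <;> simp_all [Formula.dual, Formula.UsesOnly, boxOps, diaOps]

theorem PointedModel.flip_flip (E : PointedModel.{u, v} P) : E.flip.flip = E := by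
  obtain ⟨⟨⟨W, R⟩, val⟩, s⟩ := E
  simp [PointedModel.flip]

theorem PointedModel.flip_injective :
    Function.Injective (PointedModel.flip : PointedModel.{u, v} P → PointedModel.{u, v} P) :=
  Function.LeftInverse.injective PointedModel.flip_flip

theorem PointedModel.flip_sat {φ : Formula P} (hφ : φ ∈ fragment P boxOps)
    (E : PointedModel.{u, v} P) : E.flip.Sat φ ↔ ¬ E.Sat φ.dual := by
  suffices h : ∀ t : E.World, E.flip.toModel.Sat t φ ↔ ¬ E.toModel.Sat t φ.dual from h E.point
  induction φ with
  | top => exact fun t => ⟨fun _ h => h, fun _ => trivial⟩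
  | bot => exact fun t => ⟨fun h => h.elim, fun h => h trivial⟩
  | var p => exact fun t => Iff.rfl
  | negAt p => simp [fragment, Formula.UsesOnly, boxOps] at hφ
  | and φ ψ ihφ ihψ =>
    intro t
    simp only [Model.Sat, Formula.dual, not_or, ihφ hφ.2.1 t, ihψ hφ.2.2 t]
  | or φ ψ ihφ ihψ =>
    intro t
    simp only [Model.Sat, Formula.dual, not_and_or, ihφ hφ.2.1 t, ihψ hφ.2.2 t]
  | dia φ ih => simp [fragment, Formula.UsesOnly, boxOps] at hφ
  | box φ ih =>
    intro t
    simp only [Model.Sat, Formula.dual, not_exists, not_and]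
    exact forall_congr' fun t' => imp_congr_right fun _ => ih hφ.2 t'

variable {F : Set Frame.{u}}

theorem flip_image_subset_frames {S : Set (PointedModel.{u, v} P)} :
    PointedModel.flip '' S ⊆ {E | E.toFrame ∈ F} ↔ S ⊆ {E | E.toFrame ∈ F} := by
  rw [Set.image_subset_iff]
  rfl

/-- Flipping keeps the frame and exchanges truth with falsity, so positive and negative examples
change places. -/
theorem fits_dual_iff {Epos Eneg : Set (PointedModel.{u, v} P)} {ψ : Formula P}
    (hψ : ψ ∈ fragment P boxOps) :
    (modalClass F (fragment P diaOps)).Fits Epos Eneg ψ.dual ↔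
      (modalClass F (fragment P boxOps)).Fits (PointedModel.flip '' Eneg)
        (PointedModel.flip '' Epos) ψ := by
  have h1 : ∀ E : PointedModel.{u, v} P, E ∈ (modalClass F (fragment P diaOps)).ext ψ.dual ↔
      E.flip ∈ (modalClass F (fragment P boxOps)).X \
        (modalClass F (fragment P boxOps)).ext ψ := by
    intro E
    change E.toFrame ∈ F ∧ E.Sat ψ.dual ↔ E.toFrame ∈ F ∧ ¬ (E.toFrame ∈ F ∧ E.flip.Sat ψ)
    rw [PointedModel.flip_sat hψ]
    tauto
  have h2 : ∀ E : PointedModel.{u, v} P, E ∈ (modalClass F (fragment P diaOps)).X \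
      (modalClass F (fragment P diaOps)).ext ψ.dual ↔
      E.flip ∈ (modalClass F (fragment P boxOps)).ext ψ := by
    intro E
    change E.toFrame ∈ F ∧ ¬ (E.toFrame ∈ F ∧ E.Sat ψ.dual) ↔ E.toFrame ∈ F ∧ E.flip.Sat ψ
    rw [PointedModel.flip_sat hψ]
    tauto
  simp only [ConceptClass.Fits, Set.image_subset_iff]
  rw [and_comm]
  exact and_congr (forall₂_congr fun E _ => h2 E) (forall₂_congr fun E _ => h1 E)

theorem ext_dual_eq_iff {φ ψ : Formula P} (hφ : φ ∈ fragment P boxOps)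
    (hψ : ψ ∈ fragment P boxOps) :
    (modalClass F (fragment P diaOps)).ext ψ.dual =
        (modalClass F (fragment P diaOps)).ext φ.dual ↔
      (modalClass F (fragment P boxOps)).ext ψ = (modalClass F (fragment P boxOps)).ext φ := by
  have hsat : ∀ {χ : Formula P}, χ ∈ fragment P boxOps → ∀ E : PointedModel.{u, v} P,
      E.Sat χ ↔ ¬ E.flip.Sat χ.dual := by
    intro χ hχ E
    rw [← PointedModel.flip_sat hχ, PointedModel.flip_flip]
  simp only [Set.ext_iff]
  constructor
  · intro h E
    have := h E.flip
    change E.toFrame ∈ F ∧ E.flip.Sat ψ.dual ↔ E.toFrame ∈ F ∧ E.flip.Sat φ.dual at this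
    change E.toFrame ∈ F ∧ E.Sat ψ ↔ E.toFrame ∈ F ∧ E.Sat φ
    rw [hsat hψ, hsat hφ]
    tauto
  · intro h E
    have := h E.flip
    change E.toFrame ∈ F ∧ E.flip.Sat ψ ↔ E.toFrame ∈ F ∧ E.flip.Sat φ at this
    change E.toFrame ∈ F ∧ E.Sat ψ.dual ↔ E.toFrame ∈ F ∧ E.Sat φ.dual
    rw [PointedModel.flip_sat hψ, PointedModel.flip_sat hφ] at this
    tauto

theorem isFiniteCharacterisation_dual_iff {Epos Eneg : Set (PointedModel.{u, v} P)}
    {φ : Formula P} (hφ : φ ∈ fragment P boxOps) :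
    (modalClass F (fragment P diaOps)).IsFiniteCharacterisation Epos Eneg φ.dual ↔
      (modalClass F (fragment P boxOps)).IsFiniteCharacterisation (PointedModel.flip '' Eneg)
        (PointedModel.flip '' Epos) φ := by
  constructor
  · intro h
    refine ⟨h.neg_finite.image _, h.pos_finite.image _, flip_image_subset_frames.2 h.neg_subset,
      flip_image_subset_frames.2 h.pos_subset, (fits_dual_iff hφ).1 h.fits, fun ψ hψ hfit => ?_⟩
    exact (ext_dual_eq_iff hφ hψ).1
      (h.unique ψ.dual (dual_mem_diaOps.2 hψ) ((fits_dual_iff hψ).2 hfit))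
  · intro h
    refine ⟨Set.Finite.of_finite_image h.neg_finite PointedModel.flip_injective.injOn,
      Set.Finite.of_finite_image h.pos_finite PointedModel.flip_injective.injOn,
      flip_image_subset_frames.1 h.neg_subset, flip_image_subset_frames.1 h.pos_subset,
      (fits_dual_iff hφ).2 h.fits, fun ψ hψ hfit => ?_⟩
    -- Dualising is an involution, so every competing diamond formula is the dual of a box formula.
    obtain ⟨χ, rfl⟩ : ∃ χ : Formula P, ψ = χ.dual := ⟨ψ.dual, ψ.dual_dual.symm⟩
    have hχ := dual_mem_diaOps.1 hψ
    exact (ext_dual_eq_iff hφ hχ).2 (h.unique χ hχ ((fits_dual_iff hχ).1 hfit))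

end Duality

/-! ### Primitive recursiveness of the construction -/

section Computability

open Primrec

variable {α : Type*} [Primcodable α]

theorem primrec_tag : Primrec₂ PointedGraph.tag :=
  succ.comp (Primrec₂.natPair.comp (Primrec.encode.comp fst) snd)

theorem primrec_node {ns rs : α → List ℕ} {L : α → List PointedGraph} (hns : Primrec ns)
    (hrs : Primrec rs) (hL : Primrec L) :
    Primrec fun a => PointedGraph.node (ns a) (rs a) (L a) := by
  have hz : Primrec₂ fun (_ : α) (j : ℕ) => ((0, j) : ℕ × ℕ) := pair (const 0) snd
  refine pair (list_append.comp (list_map hrs hz) (list_flatMap hL (list_map (fst.comp snd) ?_)))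
    (list_append.comp (list_map hns hz) (list_flatMap hL (list_map (snd.comp snd) ?_)))
  · exact pair (primrec_tag.comp (snd.comp fst) (fst.comp snd))
      (primrec_tag.comp (snd.comp fst) (snd.comp snd))
  · exact pair (primrec_tag.comp (snd.comp fst) (fst.comp snd)) (snd.comp snd)

theorem primrec_cone {ns : α → List ℕ} {L : α → List PointedGraph} (hns : Primrec ns)
    (hL : Primrec L) : Primrec fun a => PointedGraph.cone (ns a) (L a) :=
  primrec_node hns (list_map hL (primrec_tag.comp snd (const 0))) hL

theorem primrec_atZero {l : α → List (ℕ × ℕ)} (hl : Primrec l) :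
    Primrec fun a => (l a).flatMap fun x => if x.1 = 0 then [x.2] else [] :=
  list_flatMap hl (ite (Primrec.eq.comp (fst.comp snd) (const 0))
    (list_cons.comp (snd.comp snd) (const [])) (const []))

theorem primrec_rootSucc : Primrec PointedGraph.rootSucc := primrec_atZero fst

theorem primrec_rootFalse : Primrec PointedGraph.rootFalse := primrec_atZero snd

theorem primrec_meet : Primrec₂ PointedGraph.meet := by
  refine primrec_node
    (list_append.comp (primrec_rootFalse.comp fst) (primrec_rootFalse.comp snd))
    (list_append.comp (list_map (primrec_rootSucc.comp fst) ?_)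
      (list_map (primrec_rootSucc.comp snd) ?_))
    (list_cons.comp fst (list_cons.comp snd (const [])))
  · exact primrec_tag.comp (fst.comp fst) snd
  · exact primrec_tag.comp (snd.comp fst) snd

theorem primrec_join : Primrec₂ PointedGraph.join := by
  refine pair (list_flatMap (fst.comp fst) (list_map (fst.comp (snd.comp fst)) ?_))
    (list_flatMap (snd.comp fst) (list_flatMap (snd.comp (snd.comp fst)) ?_))
  · exact pair (Primrec₂.natPair.comp (fst.comp (snd.comp fst)) (fst.comp snd))
      (Primrec₂.natPair.comp (snd.comp (snd.comp fst)) (snd.comp snd))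
  · exact ite (Primrec.eq.comp (snd.comp (snd.comp fst)) (snd.comp snd))
      (list_cons.comp (pair (Primrec₂.natPair.comp (fst.comp (snd.comp fst)) (fst.comp snd))
        (snd.comp (snd.comp fst))) (const [])) (const [])

theorem primrec_others (ps : List ℕ) : Primrec (others ps) :=
  list_flatMap (const ps) (ite (Primrec.eq.comp snd fst) (const [])
    (list_cons.comp snd (const [])))

theorem primrec_coverStep (ps : List ℕ) : Primrec₂ (coverStep ps) := by
  have hn : Primrec fun x : ℕ × List (List PointedGraph × List PointedGraph) => x.1.unpair :=
    unpair.comp fst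
  have hr := snd.comp hn
  have hget : ∀ {k : ℕ × List (List PointedGraph × List PointedGraph) → ℕ}, Primrec k →
      Primrec fun x : ℕ × List (List PointedGraph × List PointedGraph) =>
        x.2.getD (k x) ([], []) := fun hk => (list_getD _).comp snd hk
  have hc := hget hr
  have ha := hget (fst.comp (unpair.comp hr))
  have hb := hget (snd.comp (unpair.comp hr))
  have htest : ∀ c : ℕ, PrimrecPred fun x : ℕ × List (List PointedGraph × List PointedGraph) =>
      x.1.unpair.1 = c := fun c => Primrec.eq.comp (fst.comp hn) (const c)
  refine ite (htest 0) (const _) <| ite (htest 1) (const _) <| ite (htest 2) ?_ <|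
    ite (htest 4) ?_ <| ite (htest 5) ?_ ?_
  · exact pair
      (list_cons.comp (primrec_cone ((primrec_others ps).comp hr) (const _)) (const []))
      (list_cons.comp (primrec_cone (list_cons.comp hr (const [])) (const [])) (const []))
  · exact pair (list_flatMap (fst.comp ha) (list_map ((fst.comp hb).comp fst)
      (primrec_join.comp (snd.comp fst) snd))) (list_append.comp (snd.comp ha) (snd.comp hb))
  · exact pair (list_append.comp (fst.comp ha) (fst.comp hb))
      (list_flatMap (snd.comp ha) (list_map ((snd.comp hb).comp fst)
        (primrec_meet.comp (snd.comp fst) snd)))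
  · exact pair (list_cons.comp (primrec_cone (const ps) (fst.comp hc)) (const []))
      (list_map (snd.comp hc) (primrec_cone (const []) (list_cons.comp snd (const []))))

/-- The table grows by one entry at each step, so plain primitive recursion with the whole table as
state suffices. -/
theorem primrec_cover (ps : List ℕ) : Primrec (cover ps) :=
  (primrec_coverStep ps).comp Primrec.id
    (nat_rec₁ [] (list_concat.comp snd (primrec_coverStep ps)))

theorem primrec_bound : Primrec PointedGraph.bound :=
  list_foldr (h := fun (_ : PointedGraph) (p : (ℕ × ℕ) × ℕ) => p.1.2 + p.2) fst (const 0)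
    (nat_add.comp (snd.comp (fst.comp snd)) (snd.comp snd))

theorem primrec_toCode (ps : List ℕ) : Primrec (PointedGraph.toCode ps) := by
  refine pair primrec_bound (pair fst (list_flatMap (list_range.comp (succ.comp primrec_bound))
    (list_flatMap (const ps) (ite ?_ (const []) (list_cons.comp ?_ (const []))))))
  -- The test in `toCode` is a bounded existential over a list, the form to which this closure
  -- property applies.
  · exact Primrec.eq.exists_mem_list.comp (snd.comp (fst.comp fst)) (pair (snd.comp fst) snd)
  · exact pair (snd.comp fst) snd

theorem effectivelyCharacterisable_box (P : Type v) [Finite P] {F : Set Frame.{u}}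
    (hF : finiteFrames ⊆ F) :
    EffectivelyCharacterisable (modalClass F (fragment P boxOps)) := by
  intro num hnum
  -- The finite list of variable numbers is a constant built into the algorithm, so no computability
  -- of `num` is needed.
  obtain ⟨ps, hps⟩ : ∃ ps : List ℕ, ∀ p, num p ∈ ps :=
    ⟨(Set.finite_range num).toFinset.toList, fun p => by simp⟩
  refine ⟨fun n => ((cover ps n).1.map (PointedGraph.toCode ps),
    (cover ps n).2.map (PointedGraph.toCode ps)), Primrec.to_comp ?_, fun φ hφ => ?_⟩
  · exact pair (list_map (fst.comp (primrec_cover ps)) ((primrec_toCode ps).comp snd))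
      (list_map (snd.comp (primrec_cover ps)) ((primrec_toCode ps).comp snd))
  · obtain ⟨h, h'⟩ := cover_code hnum hps hφ
    exact isFiniteCharacterisation_of_covers hps hF hφ h h'

end Computability

theorem EffectivelyCharacterisable.admits {P : Type v} [Finite P]
    {K : ConceptClass (PointedModel.{u, v} P) (Formula P)} (h : EffectivelyCharacterisable K) :
    K.AdmitsFiniteCharacterisations := by
  obtain ⟨num, hnum⟩ := exists_injective_nat P
  obtain ⟨f, -, hf⟩ := h num hnum
  exact fun φ hφ => ⟨_, _, hf φ hφ⟩

end ModalChar

theorem mainTheorem7 (P : Type v) [Finite P] (F : Set ModalChar.Frame.{u})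
    (hF : F = ModalChar.finiteFrames ∨ F = ModalChar.allFrames) :
    (ModalChar.modalClass F
        (ModalChar.fragment P ModalChar.boxOps)).AdmitsFiniteCharacterisations ∧
    ModalChar.EffectivelyCharacterisable
      (ModalChar.modalClass F (ModalChar.fragment P ModalChar.boxOps)) ∧
    ∀ φ ∈ ModalChar.fragment P ModalChar.boxOps,
      φ.dual ∈ ModalChar.fragment P ModalChar.diaOps ∧
      ∀ Epos Eneg : Set (ModalChar.PointedModel.{u, v} P),
        (ModalChar.modalClass F
            (ModalChar.fragment P ModalChar.diaOps)).IsFiniteCharacterisation Epos Eneg φ.dual ↔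
        (ModalChar.modalClass F
            (ModalChar.fragment P ModalChar.boxOps)).IsFiniteCharacterisation
          (ModalChar.PointedModel.flip '' Eneg) (ModalChar.PointedModel.flip '' Epos) φ := by
  have hfin : ModalChar.finiteFrames ⊆ F := by
    rcases hF with rfl | rfl
    · exact subset_rfl
    · exact Set.subset_univ _
  have heff := ModalChar.effectivelyCharacterisable_box P hfin
  exact ⟨heff.admits, heff, fun φ hφ => ⟨ModalChar.dual_mem_diaOps.2 hφ,
    fun _ _ => ModalChar.isFiniteCharacterisation_dual_iff hφ⟩⟩
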